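/- For $n\ge 0$ let $\mathfrak S_n$ be the set of permutations of $[n]=\{1,\dots,n\}$, and let $\mathcal B_n$ be the set of permutations $\sigma$ of $\{\pm1,\dots,\pm n\}$ with $\sigma(-i)=-\sigma(i)$ for all $i$; for $\sigma\in\mathcal B_n$ put $\sigma(0)=0$. A position $i$ is an alternating descent of $\sigma$ if either $i$ is odd and $\sigma(i)>\sigma(i+1)$, or $i$ is even and $\sigma(i)<\sigma(i+1)$. Let $\hat d(\sigma)$ be the number of alternating descents $i\in\{1,\dots,n-1\}$ of $\sigma\in\mathfrak S_n$, let $\hat d_B(\sigma)$ be the number of alternating descents $i\in\{0,1,\dots,n-1\}$ of $\sigma\in\mathcal B_n$, and set $$\hat A_n(x)=\sum_{\sigma\in\mathfrak S_n}x^{\hat d(\sigma)},\qquad \hat B_n(x)=\sum_{\sigma\in\mathcal B_n}x^{\hat d_B(\sigma)}.$$ Let $K$ be a field of characteristic $0$ and let $x\in K$ with $x\neq1$ (for example, $K=\mathbb Q(x)$ with $x$ an indeterminate). Then, as formal power series in $z$ over $K$, $$\sum_{n\ge1}\hat A_n(x)\frac{z^n}{n!}=\frac{\sec((1-x)z)+\tan((1-x)z)-1}{1-x\bigl(\sec((1-x)z)+\tan((1-x)z)\bigr)},$$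 $$\sum_{n\ge0}\hat B_n(x)\frac{z^n}{n!}=\frac{x-1}{(x-1)\cos(z(1-x))+(x+1)\sin(z(1-x))}.$$ -/

import Mathlib

/-- The word `w` has an alternating descent at position `i`: either `w i > w (i+1)` and `i` is odd,
or `w i < w (i+1)` and `i` is even. -/
def IsAltDescent (w : ℕ → ℤ) (i : ℕ) : Prop :=
  (w i > w (i + 1) ∧ Odd i) ∨ (w i < w (i + 1) ∧ Even i)

instance (w : ℕ → ℤ) : DecidablePred (IsAltDescent w) := fun i => by
  unfold IsAltDescent; infer_instance

/-- The one-line word of a permutation `σ` of `[n] = {1, …, n}`, indexed by the positions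
`1, …, n`; here `Fin n` stands for `[n]` through `j ↦ j + 1`. Other positions are never read. -/
def wordA {n : ℕ} (σ : Equiv.Perm (Fin n)) (i : ℕ) : ℤ :=
  if h : 1 ≤ i ∧ i ≤ n then (σ ⟨i - 1, by omega⟩ : ℕ) + 1 else 0

/-- The set of alternating descent positions `i ∈ [n-1]` of `σ ∈ 𝔖ₙ`. -/
def altDescentsA {n : ℕ} (σ : Equiv.Perm (Fin n)) : Finset ℕ :=
  (Finset.Ico 1 n).filter (IsAltDescent (wordA σ))

/-- The alternating Eulerian polynomial of type A. -/
noncomputable def altEulerianA (n : ℕ) : Polynomial ℤ :=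
  ∑ σ : Equiv.Perm (Fin n), Polynomial.X ^ (altDescentsA σ).card

/-- The set `[±n] = {1, …, n} ∪ {-1, …, -n}`. -/
abbrev PlusMinus (n : ℕ) : Type := {j : ℤ // j ∈ (Finset.Icc (-(n : ℤ)) n).erase 0}

/-- Permutations of type B: the permutations `σ` of `[±n]` with `σ(-i) = -σ(i)`. -/
abbrev SignedPerm (n : ℕ) : Type :=
  {σ : Equiv.Perm (PlusMinus n) //
    ∀ i j : PlusMinus n, (j : ℤ) = -(i : ℤ) → (σ j : ℤ) = -(σ i : ℤ)}

/-- The word `σ(0) σ(1) ⋯ σ(n)` of a type B permutation, with `σ(0) = 0`.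
Positions larger than `n` are never read. -/
noncomputable def wordB {n : ℕ} (σ : SignedPerm n) (i : ℕ) : ℤ :=
  if h : (i : ℤ) ∈ (Finset.Icc (-(n : ℤ)) n).erase 0 then (σ.1 ⟨i, h⟩ : ℤ) else 0

/-- The set of alternating descent positions `i ∈ {0} ∪ [n-1]` of a type B permutation. -/
noncomputable def altDescentsB {n : ℕ} (σ : SignedPerm n) : Finset ℕ :=
  (Finset.range n).filter (IsAltDescent (wordB σ))

/-- The alternating Eulerian polynomial of type B. -/
noncomputable def altEulerianB (n : ℕ) : Polynomial ℤ :=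
  ∑ σ : SignedPerm n, Polynomial.X ^ (altDescentsB σ).card

section Series

variable (K : Type*) [Field K] [CharZero K]

/-- The formal power series of the secant. -/
noncomputable def secSeries : PowerSeries K := (PowerSeries.cos K)⁻¹

/-- The formal power series of the tangent. -/
noncomputable def tanSeries : PowerSeries K := PowerSeries.sin K * (PowerSeries.cos K)⁻¹

theorem constantCoeff_cos_eq : PowerSeries.constantCoeff (PowerSeries.cos K) = 1 := by
  rw [← PowerSeries.coeff_zero_eq_constantCoeff_apply, PowerSeries.cos, PowerSeries.coeff_mk]
  simp

theorem constantCoeff_sin_eq : PowerSeries.constantCoeff (PowerSeries.sin K) = 0 := by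
  rw [← PowerSeries.coeff_zero_eq_constantCoeff_apply, PowerSeries.sin, PowerSeries.coeff_mk]
  simp

/-- The inverse of the cosine series is a genuine one. -/
theorem cos_mul_secSeries : PowerSeries.cos K * secSeries K = 1 :=
  PowerSeries.mul_inv_cancel _ (by simp [constantCoeff_cos_eq])

variable {K}

/-- `sec((1-x)z) + tan((1-x)z)` as a formal power series in `z`. -/
noncomputable def secTan (x : K) : PowerSeries K :=
  PowerSeries.rescale (1 - x) (secSeries K) + PowerSeries.rescale (1 - x) (tanSeries K)

/-- The denominator `1 - x (sec((1-x)z) + tan((1-x)z))` of the type A formula. -/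
noncomputable def denomA (x : K) : PowerSeries K := 1 - PowerSeries.C x * secTan x

/-- The denominator `(x-1) cos(z(1-x)) + (x+1) sin(z(1-x))` of the type B formula. -/
noncomputable def denomB (x : K) : PowerSeries K :=
  PowerSeries.C (x - 1) * PowerSeries.rescale (1 - x) (PowerSeries.cos K) +
    PowerSeries.C (x + 1) * PowerSeries.rescale (1 - x) (PowerSeries.sin K)

theorem constantCoeff_rescale_eq {R : Type*} [CommRing R] (a : R) (f : PowerSeries R) :
    PowerSeries.constantCoeff (PowerSeries.rescale a f) = PowerSeries.constantCoeff f := by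
  rw [← PowerSeries.coeff_zero_eq_constantCoeff_apply, PowerSeries.coeff_rescale]
  simp

/-- The inverse of `denomA x` is a genuine one for `x ≠ 1`. -/
theorem denomA_mul_inv (x : K) (hx : x ≠ 1) : denomA x * (denomA x)⁻¹ = 1 := by
  apply PowerSeries.mul_inv_cancel
  have h : (1 : K) - x ≠ 0 := sub_ne_zero.mpr hx.symm
  simpa [denomA, secTan, secSeries, tanSeries, constantCoeff_rescale_eq, constantCoeff_cos_eq,
    constantCoeff_sin_eq] using h

/-- The inverse of `denomB x` is a genuine one for `x ≠ 1`. -/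
theorem denomB_mul_inv (x : K) (hx : x ≠ 1) : denomB x * (denomB x)⁻¹ = 1 := by
  apply PowerSeries.mul_inv_cancel
  have h : x - 1 ≠ 0 := sub_ne_zero.mpr hx
  simpa [denomB, constantCoeff_rescale_eq, constantCoeff_cos_eq,
    constantCoeff_sin_eq] using h

end Series

/-! Put a letter p at position i in front of the words to be counted, and sum the weights over the
arrangements of n letters, r of which lie below p (in absolute value for type B, with p ≥ 0). Call
the sum T(n, r, i). It has period 2 in i. Raising p past a single letter matters only when that
letter comes next, and then turns an ascent into a descent, so T(n+1, r+1, i) = T(n+1, r, i) +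
(-1)^i (1-x) T(n, r, i+1). Iterating this Newton-style gives binomial sums whose signs are those of
cosine and sine (`egf_diagonal`). With D_i and Z_i the exponential generating functions of T(n, n,
i) and T(n, 0, i), and cos, sin taken at (1-x)z, D_0 = cos Z_0 + sin Z_1, D_1 = cos Z_1 - sin Z_0.

Symmetries close the system. In type A, reversing the order of the letters gives Z_1 = D_0 and D_1 =
Z_0, and comparing first steps gives Z_0 = 1 + x(D_0 - 1); the polynomials are the coefficients of
D_0. In type B, changing all signs gives Z_1 = Z_0, and comparing first steps gives D_1 = 1 + x(D_0
- 1); the polynomials are the coefficients of Z_0. Solving the linear equations yields both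
formulas. -/

/-- The weight of a descent at position `i`: `x` if `i` is odd and `1` if `i` is even. The weight of
an ascent at `i` is `descentWeight x (i + 1)`. -/
def descentWeight {R : Type*} [CommRing R] (x : R) (i : ℕ) : R := if Even i then 1 else x

/-! ### Multiplicative weights of words. -/

section Weights

variable {R : Type*} [CommRing R] (x : R)

theorem descentWeight_add_two (i : ℕ) : descentWeight x (i + 2) = descentWeight x i := by
  simp [descentWeight, Nat.even_add]

theorem descentWeight_sub_succ (i : ℕ) :
    descentWeight x i - descentWeight x (i + 1) = (-1) ^ i * (1 - x) := by
  rcases Nat.even_or_odd i with h | h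
  · simp [descentWeight, h, h.neg_one_pow, Nat.even_add_one]
  · simp [descentWeight, Nat.not_even_iff_odd.mpr h, h.neg_one_pow, Nat.even_add_one]

/-- The weight of the step from the letter `a` at position `i` to the letter `b`: `x` for an
alternating descent and `1` otherwise. -/
def stepWeight (i : ℕ) (a b : ℤ) : R :=
  if (a > b ∧ Odd i) ∨ (a < b ∧ Even i) then x else 1

theorem stepWeight_of_gt {i : ℕ} {a b : ℤ} (h : b < a) :
    stepWeight x i a b = descentWeight x i := by
  have h' : ¬ a < b := by omega
  by_cases hi : Even i <;> simp [stepWeight, descentWeight, h, h', hi, ← Nat.not_even_iff_odd]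

theorem stepWeight_of_lt {i : ℕ} {a b : ℤ} (h : a < b) :
    stepWeight x i a b = descentWeight x (i + 1) := by
  have h' : ¬ b < a := by omega
  by_cases hi : Even i <;>
    simp [stepWeight, descentWeight, h, h', hi, Nat.even_add_one]

/-- The weight of the word `p, f 0, f 1, …` whose first letter `p` is at position `i`. -/
def wordWeight {n : ℕ} (i : ℕ) (p : ℤ) (f : Fin n → ℤ) : R :=
  ∏ j : Fin n, stepWeight x (i + j) ((Fin.cons p f : Fin (n + 1) → ℤ) j.castSucc) (f j)

theorem wordWeight_cons {n : ℕ} (i : ℕ) (p a : ℤ) (g : Fin n → ℤ) :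
    wordWeight x i p (Fin.cons a g : Fin (n + 1) → ℤ) =
      stepWeight x i p a * wordWeight x (i + 1) a g := by
  unfold wordWeight
  rw [Fin.prod_univ_succ]
  simp only [Fin.val_zero, add_zero, Fin.castSucc_zero, Fin.cons_zero, Fin.val_succ,
    Fin.castSucc_succ, Fin.cons_succ, add_assoc, add_comm 1]

end Weights

/-! ### Sums over words, split by first letter; `κ` will be `id` in type A and `abs` in type B. -/

section Words

open Classical in
/-- The words of length `n` in the alphabet `V` on whose letters `κ` takes distinct values. -/
noncomputable def distinctWords (κ : ℤ → ℤ) (V : Finset ℤ) (n : ℕ) : Finset (Fin n → ℤ) :=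
  (Fintype.piFinset fun _ => V).filter fun f => Function.Injective (κ ∘ f)

theorem mem_distinctWords {κ : ℤ → ℤ} {V : Finset ℤ} {n : ℕ} {f : Fin n → ℤ} :
    f ∈ distinctWords κ V n ↔ (∀ j, f j ∈ V) ∧ Function.Injective (κ ∘ f) := by
  simp [distinctWords, Fintype.mem_piFinset]

theorem cons_mem_distinctWords {κ : ℤ → ℤ} {V : Finset ℤ} {n : ℕ} {a : ℤ} {g : Fin n → ℤ} :
    (Fin.cons a g : Fin (n + 1) → ℤ) ∈ distinctWords κ V (n + 1) ↔
      a ∈ V ∧ g ∈ distinctWords κ (V.filter fun b => κ b ≠ κ a) n := by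
  have h : κ ∘ (Fin.cons a g : Fin (n + 1) → ℤ) = Fin.cons (κ a) (κ ∘ g) := by
    funext j
    refine Fin.cases ?_ (fun j => ?_) j <;> simp
  simp only [mem_distinctWords, h, Fin.cons_injective_iff, Fin.forall_fin_succ, Fin.cons_zero,
    Fin.cons_succ, Finset.mem_filter, Set.mem_range, not_exists, Function.comp_apply]
  constructor
  · rintro ⟨⟨h1, h2⟩, h3, h4⟩
    exact ⟨h1, fun j => ⟨h2 j, h3 j⟩, h4⟩
  · rintro ⟨h1, h2, h4⟩
    exact ⟨⟨h1, fun j => (h2 j).1⟩, fun j => (h2 j).2, h4⟩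

theorem sum_distinctWords_succ {M : Type*} [AddCommMonoid M] (κ : ℤ → ℤ) (V : Finset ℤ) (n : ℕ)
    (F : (Fin (n + 1) → ℤ) → M) :
    ∑ f ∈ distinctWords κ V (n + 1), F f =
      ∑ a ∈ V, ∑ g ∈ distinctWords κ (V.filter fun b => κ b ≠ κ a) n, F (Fin.cons a g) := by
  rw [Finset.sum_sigma']
  symm
  refine Finset.sum_bij' (fun p _ => (Fin.cons p.1 p.2 : Fin (n + 1) → ℤ))
    (fun f _ => ⟨f 0, Fin.tail f⟩) ?_ ?_ ?_ ?_ ?_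
  · rintro ⟨a, g⟩ h
    exact cons_mem_distinctWords.2 (Finset.mem_sigma.1 h)
  · intro f hf
    rw [← Fin.cons_self_tail f] at hf
    exact Finset.mem_sigma.2 (cons_mem_distinctWords.1 hf)
  · rintro ⟨a, g⟩ _
    simp
  · intro f _
    simp
  · intro _ _
    rfl

variable {R : Type*} [CommRing R] (x : R)

/-- The total weight of the words `p, f 0, …, f (n - 1)` with `f` in `distinctWords κ V n`. -/
noncomputable def wordSum (κ : ℤ → ℤ) (V : Finset ℤ) (n i : ℕ) (p : ℤ) : R :=
  ∑ f ∈ distinctWords κ V n, wordWeight x i p f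

theorem wordSum_zero (κ : ℤ → ℤ) (V : Finset ℤ) (i : ℕ) (p : ℤ) :
    wordSum x κ V 0 i p = 1 := by
  have h : distinctWords κ V 0 = Finset.univ := by
    ext f
    simp only [mem_distinctWords, Function.injective_of_subsingleton, Finset.mem_univ,
      IsEmpty.forall_iff, and_self]
  simp [wordSum, h, wordWeight]

theorem wordSum_succ (κ : ℤ → ℤ) (V : Finset ℤ) (n i : ℕ) (p : ℤ) :
    wordSum x κ V (n + 1) i p = ∑ a ∈ V, stepWeight x i p a *
      wordSum x κ (V.filter fun b => κ b ≠ κ a) n (i + 1) a := by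
  simp only [wordSum, sum_distinctWords_succ, wordWeight_cons, Finset.mul_sum]

end Words

/-! ### Ranks in a finite set of integers. -/

section Rank

/-- The number of elements of `S` below `p`. -/
def rankIn (S : Finset ℤ) (p : ℤ) : ℕ := (S.filter (· < p)).card

theorem rankIn_lt_rankIn_iff {S : Finset ℤ} {a p : ℤ} (ha : a ∈ S) :
    rankIn S a < rankIn S p ↔ a < p := by
  constructor
  · intro h
    by_contra hp
    refine absurd h (not_lt.2 (Finset.card_le_card fun b => ?_))
    simp only [Finset.mem_filter]
    exact fun hb => ⟨hb.1, hb.2.trans_le (not_lt.1 hp)⟩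
  · intro h
    refine Finset.card_lt_card (Finset.ssubset_iff.2 ⟨a, by simp, fun b => ?_⟩)
    simp only [Finset.mem_insert, Finset.mem_filter]
    rintro (rfl | hb)
    · exact ⟨ha, h⟩
    · exact ⟨hb.1, hb.2.trans h⟩

theorem rankIn_erase_self (S : Finset ℤ) (a : ℤ) : rankIn (S.erase a) a = rankIn S a := by
  unfold rankIn
  congr 1
  ext b
  simp only [Finset.mem_filter, Finset.mem_erase]
  constructor
  · exact fun h => ⟨h.1.2, h.2⟩
  · exact fun h => ⟨⟨h.2.ne, h.1⟩, h.2⟩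

theorem rankIn_lt_card {S : Finset ℤ} {a : ℤ} (ha : a ∈ S) : rankIn S a < S.card :=
  Finset.card_lt_card (Finset.filter_ssubset.2 ⟨a, ha, lt_irrefl a⟩)

theorem sum_rankIn {M : Type*} [AddCommMonoid M] (S : Finset ℤ) (F : ℕ → M) :
    ∑ a ∈ S, F (rankIn S a) = ∑ j ∈ Finset.range S.card, F j := by
  have hinj : Set.InjOn (rankIn S) S := by
    intro a ha b hb h
    rcases lt_trichotomy a b with hab | hab | hab
    · exact absurd h ((rankIn_lt_rankIn_iff ha).2 hab).ne
    · exact hab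
    · exact absurd h ((rankIn_lt_rankIn_iff hb).2 hab).ne'
  have himg : S.image (rankIn S) = Finset.range S.card := by
    refine Finset.eq_of_subset_of_card_le (fun j hj => ?_) ?_
    · obtain ⟨a, ha, rfl⟩ := Finset.mem_image.1 hj
      exact Finset.mem_range.2 (rankIn_lt_card ha)
    · rw [Finset.card_image_of_injOn hinj, Finset.card_range]
  rw [← himg, Finset.sum_image hinj]

end Rank

/-! ### The arrays T(n, r, i): difference equation and symmetries. -/

section Arrays

variable {R : Type*} [CommRing R] (x : R)

/-- The total weight of the words `p, a₁, …, aₙ`, the first letter being at position `i`, in which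
`a₁, …, aₙ` runs through the arrangements of a set of `n` integers of which `r` are below `p`. -/
def rankSumA : ℕ → ℕ → ℕ → R
  | 0, _, _ => 1
  | n + 1, r, i => ∑ j ∈ Finset.range (n + 1),
      descentWeight x (if j < r then i else i + 1) * rankSumA n j (i + 1)

/-- The total weight of the words `p, ±a₁, …, ±aₙ` with `0 ≤ p`, the first letter being at
position `i`, in which `a₁, …, aₙ` runs through the arrangements of a set of `n` positive integers
of which `r` are below `p`, and the signs are arbitrary. -/
def rankSumB : ℕ → ℕ → ℕ → R
  | 0, _, _ => 1
  | n + 1, r, i => ∑ j ∈ Finset.range (n + 1),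
      (descentWeight x (if j < r then i else i + 1) * rankSumB n j (i + 1) +
        descentWeight x i * rankSumB n j i)

theorem descentWeight_ite_add_two (c : Prop) [Decidable c] (i : ℕ) :
    descentWeight x (if c then i + 2 else i + 2 + 1) = descentWeight x (if c then i else i + 1) := by
  split_ifs
  · exact descentWeight_add_two x i
  · exact descentWeight_add_two x (i + 1)

theorem rankSumA_add_two (n r i : ℕ) : rankSumA x n r (i + 2) = rankSumA x n r i := by
  induction n generalizing r i with
  | zero => rfl
  | succ n ih =>
    simp only [rankSumA]
    refine Finset.sum_congr rfl fun j _ => ?_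
    rw [descentWeight_ite_add_two, add_right_comm, ih]

theorem rankSumB_add_two (n r i : ℕ) : rankSumB x n r (i + 2) = rankSumB x n r i := by
  induction n generalizing r i with
  | zero => rfl
  | succ n ih =>
    simp only [rankSumB]
    refine Finset.sum_congr rfl fun j _ => ?_
    rw [descentWeight_ite_add_two, add_right_comm, ih, ih, descentWeight_add_two]

/-- Only the term j = r changes: there the first step turns from an ascent into a descent. -/
theorem sum_descentWeight_step (n r i : ℕ) (hr : r ≤ n) (F : ℕ → R) :
    ∑ j ∈ Finset.range (n + 1), descentWeight x (if j < r + 1 then i else i + 1) * F j =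
      ∑ j ∈ Finset.range (n + 1), descentWeight x (if j < r then i else i + 1) * F j +
        (-1) ^ i * (1 - x) * F r := by
  have hmem : r ∈ Finset.range (n + 1) := Finset.mem_range.2 (by omega)
  rw [← Finset.add_sum_erase _ _ hmem, ← Finset.add_sum_erase (a := r) _ _ hmem,
    ← descentWeight_sub_succ]
  have h : ∀ j ∈ (Finset.range (n + 1)).erase r,
      descentWeight x (if j < r + 1 then i else i + 1) * F j =
        descentWeight x (if j < r then i else i + 1) * F j := by
    intro j hj
    have hne := (Finset.mem_erase.1 hj).1
    have hiff : j < r + 1 ↔ j < r := by omega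
    simp only [hiff]
  rw [Finset.sum_congr rfl h]
  simp only [Nat.lt_succ_self, if_true, lt_irrefl, if_false]
  ring

theorem rankSumA_step (n r i : ℕ) (hr : r ≤ n) :
    rankSumA x (n + 1) (r + 1) i =
      rankSumA x (n + 1) r i + (-1) ^ i * (1 - x) * rankSumA x n r (i + 1) :=
  sum_descentWeight_step x n r i hr _

theorem rankSumB_step (n r i : ℕ) (hr : r ≤ n) :
    rankSumB x (n + 1) (r + 1) i =
      rankSumB x (n + 1) r i + (-1) ^ i * (1 - x) * rankSumB x n r (i + 1) := by
  simp only [rankSumB, Finset.sum_add_distrib]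
  rw [sum_descentWeight_step x n r i hr]
  ring

/-- Reversing the order of the letters exchanges ascents and descents, which has the same effect on
weights as shifting positions by one. -/
theorem rankSumA_reflect (n r i : ℕ) (hr : r ≤ n) :
    rankSumA x n (n - r) (i + 1) = rankSumA x n r i := by
  induction n generalizing r i with
  | zero => rfl
  | succ n ih =>
    simp only [rankSumA]
    rw [← Finset.sum_range_reflect]
    refine Finset.sum_congr rfl fun j hj => ?_
    have hj' : j ≤ n := Nat.lt_succ_iff.1 (Finset.mem_range.1 hj)
    have hidx : n + 1 - 1 - j = n - j := by omega
    have hiff : n - j < n + 1 - r ↔ ¬ j < r := by omega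
    rw [hidx, ih j (i + 1) hj']
    simp only [hiff]
    by_cases h : j < r
    · simp [h, descentWeight_add_two]
    · simp [h]

/-- When p is below all the absolute values, changing every sign of the letters after p exchanges
ascents and descents. In the recursion the two summands trade places. -/
theorem rankSumB_zero_succ (n i : ℕ) : rankSumB x n 0 (i + 1) = rankSumB x n 0 i := by
  cases n with
  | zero => rfl
  | succ n =>
    simp only [rankSumB, Nat.not_lt_zero, if_false]
    refine Finset.sum_congr rfl fun j _ => ?_
    rw [rankSumB_add_two, descentWeight_add_two]
    ring

theorem rankSumA_succ_zero (n : ℕ) :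
    rankSumA x (n + 1) 0 0 = x * rankSumA x (n + 1) (n + 1) 0 := by
  simp only [rankSumA, Finset.mul_sum]
  refine Finset.sum_congr rfl fun j hj => ?_
  simp [Finset.mem_range.1 hj, descentWeight]

/-- When p exceeds all the absolute values, the first step is a descent, of weight x at position 1
and 1 at position 0. The remaining sums agree because both signs occur and the period is 2. -/
theorem rankSumB_diag_one (n : ℕ) :
    rankSumB x (n + 1) (n + 1) 1 = x * rankSumB x (n + 1) (n + 1) 0 := by
  simp only [rankSumB, Finset.mul_sum]
  refine Finset.sum_congr rfl fun j hj => ?_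
  have h := rankSumB_add_two x n j 0
  rw [zero_add] at h
  simp only [Finset.mem_range.1 hj, if_true, descentWeight, h]
  simp [add_comm, mul_add]

end Arrays

/-! ### Word sums depend only on size, rank and position. -/

section WordSums

variable {R : Type*} [CommRing R] (x : R)

theorem wordSum_id (n : ℕ) (V : Finset ℤ) (hV : V.card = n) (i : ℕ) (p : ℤ) (hp : p ∉ V) :
    wordSum x id V n i p = rankSumA x n (rankIn V p) i := by
  induction n generalizing V i p with
  | zero => rw [wordSum_zero, rankSumA]
  | succ n ih =>
    rw [wordSum_succ, rankSumA, ← hV, ← sum_rankIn V fun j =>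
      descentWeight x (if j < rankIn V p then i else i + 1) * rankSumA x n j (i + 1)]
    refine Finset.sum_congr rfl fun a ha => ?_
    have hfil : (V.filter fun b => id b ≠ id a) = V.erase a := by
      ext b; simp [and_comm]
    rw [hfil, ih (V.erase a) (by rw [Finset.card_erase_of_mem ha, hV]; rfl) (i + 1) a (by simp),
      rankIn_erase_self]
    simp only [rankIn_lt_rankIn_iff ha]
    have hne : a ≠ p := fun h => hp (h ▸ ha)
    rcases lt_or_gt_of_ne hne with h | h
    · rw [stepWeight_of_gt x h, if_pos h]
    · rw [stepWeight_of_lt x h, if_neg h.not_gt]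

theorem sum_abs_mem {M : Type*} [AddCommMonoid M] {V P : Finset ℤ} (hP : ∀ m ∈ P, 0 < m)
    (hV : ∀ a, a ∈ V ↔ |a| ∈ P) (F : ℤ → M) :
    ∑ a ∈ V, F a = ∑ m ∈ P, (F m + F (-m)) := by
  have hVP : V = P ∪ P.image Neg.neg := by
    ext a
    simp only [hV, Finset.mem_union, Finset.mem_image]
    constructor
    · intro h
      rcases abs_choice a with ha | ha
      · exact Or.inl (ha ▸ h)
      · exact Or.inr ⟨|a|, h, by omega⟩
    · rintro (h | ⟨m, h, rfl⟩)
      · rwa [abs_of_pos (hP a h)]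
      · rwa [abs_neg, abs_of_pos (hP m h)]
  have hdisj : Disjoint P (P.image Neg.neg) := by
    rw [Finset.disjoint_left]
    intro a ha h
    obtain ⟨m, hm, rfl⟩ := Finset.mem_image.1 h
    have h1 := hP m hm
    have h2 := hP _ ha
    omega
  rw [hVP, Finset.sum_union hdisj, Finset.sum_image neg_injective.injOn, Finset.sum_add_distrib]

/-- A negative p reduces to |p| by negating the whole word, at the cost of moving the position by
one. -/
theorem wordSum_abs (n : ℕ) (P V : Finset ℤ) (hP : ∀ m ∈ P, 0 < m) (hV : ∀ a, a ∈ V ↔ |a| ∈ P)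
    (hcard : P.card = n) (i : ℕ) (p : ℤ) (hp : |p| ∉ P) :
    wordSum x abs V n i p = rankSumB x n (rankIn P |p|) (if 0 ≤ p then i else i + 1) := by
  induction n generalizing P V i p with
  | zero => rw [wordSum_zero, rankSumB]
  | succ n ih =>
    have hrec : ∀ m ∈ P, ∀ a : ℤ, |a| = m →
        wordSum x abs (V.filter fun b => |b| ≠ |a|) n (i + 1) a =
          rankSumB x n (rankIn P m) (if 0 ≤ a then i + 1 else i + 2) := by
      intro m hm a ha
      rw [ih (P.erase m) _ (fun k hk => hP k (Finset.mem_of_mem_erase hk)) _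
        (by rw [Finset.card_erase_of_mem hm, hcard]; rfl) (i + 1) a (by simp [ha]), ha,
        rankIn_erase_self]
      intro b
      simp [hV, ha, and_comm]
    rw [wordSum_succ, sum_abs_mem hP hV, rankSumB, ← hcard, ← sum_rankIn P fun j =>
      descentWeight x (if j < rankIn P |p| then if 0 ≤ p then i else i + 1
        else (if 0 ≤ p then i else i + 1) + 1) * rankSumB x n j ((if 0 ≤ p then i else i + 1) + 1) +
        descentWeight x (if 0 ≤ p then i else i + 1) *
          rankSumB x n j (if 0 ≤ p then i else i + 1)]
    refine Finset.sum_congr rfl fun m hm => ?_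
    have hm0 := hP m hm
    have hne : m ≠ |p| := fun h => hp (h ▸ hm)
    rw [hrec m hm m (abs_of_pos hm0), hrec m hm (-m) (by rw [abs_neg, abs_of_pos hm0]),
      if_pos hm0.le, if_neg (by omega : ¬ 0 ≤ -m), rankSumB_add_two]
    simp only [rankIn_lt_rankIn_iff hm]
    by_cases h0 : 0 ≤ p
    · rw [abs_of_nonneg h0] at hne ⊢
      rw [stepWeight_of_gt x (by omega : -m < p)]
      simp only [h0, if_true]
      rcases lt_or_gt_of_ne hne with h | h
      · rw [stepWeight_of_gt x h, if_pos h]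
      · rw [stepWeight_of_lt x h, if_neg h.not_gt]
    · rw [abs_of_neg (not_le.1 h0)] at hne ⊢
      rw [stepWeight_of_lt x (by omega : p < m)]
      simp only [h0, if_false]
      -- For p < 0 the letters m and -m exchange roles: the step to m is always an ascent, and the
      -- step to -m depends on comparing m with |p|.
      rw [rankSumB_add_two, add_comm]
      congr 2
      rcases lt_or_gt_of_ne hne with h | h
      · rw [stepWeight_of_lt x (by omega : p < -m), if_pos h]
      · rw [stepWeight_of_gt x (by omega : -m < p), if_neg h.not_gt, descentWeight_add_two]

end WordSums

/-! ### From permutations and signed permutations to words. -/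

section Permutations

variable {K : Type*} [Field K] (x : K)

theorem pow_card_filter_eq_prod (s : Finset ℕ) (W : ℕ → ℤ) :
    x ^ (s.filter (IsAltDescent W)).card = ∏ i ∈ s, stepWeight x i (W i) (W (i + 1)) := by
  rw [← Finset.prod_const, Finset.prod_filter]
  rfl

theorem wordWeight_eq_prod_range {n : ℕ} (p : ℤ) (f : Fin n → ℤ) (W : ℕ → ℤ) (h0 : W 0 = p)
    (hW : ∀ j : Fin n, W (j + 1) = f j) :
    wordWeight x 0 p f = ∏ i ∈ Finset.range n, stepWeight x i (W i) (W (i + 1)) := by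
  rw [wordWeight, ← Fin.prod_univ_eq_prod_range (fun i => stepWeight x i (W i) (W (i + 1))) n]
  have hcons : ∀ j : Fin (n + 1), (Fin.cons p f : Fin (n + 1) → ℤ) j = W j := by
    intro j
    refine Fin.cases ?_ (fun j => ?_) j
    · simp [h0]
    · simp [hW]
  refine Finset.prod_congr rfl fun j _ => ?_
  rw [hcons, hW, zero_add, Fin.val_castSucc]

theorem wordA_succ {n : ℕ} (σ : Equiv.Perm (Fin n)) (j : Fin n) :
    wordA σ (j + 1) = (σ j : ℕ) + 1 := by
  have h : 1 ≤ (j : ℕ) + 1 ∧ (j : ℕ) + 1 ≤ n := ⟨by omega, j.2⟩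
  rw [wordA, dif_pos h]
  rfl

theorem pow_card_altDescentsA {n : ℕ} (σ : Equiv.Perm (Fin n)) :
    x ^ (altDescentsA σ).card = wordWeight x 0 (n + 1) fun j => ((σ j : ℕ) + 1 : ℤ) := by
  -- The extra letter n + 1 at position 0 exceeds all others, so it creates a descent at an even
  -- position, of weight 1.
  rw [wordWeight_eq_prod_range x (n + 1) _ (Function.update (wordA σ) 0 (n + 1)) (by simp)
    (fun j => by simp [wordA_succ]), altDescentsA, pow_card_filter_eq_prod]
  cases n with
  | zero => simp
  | succ n =>
    rw [Finset.range_eq_Ico, Finset.prod_eq_prod_Ico_succ_bot (Nat.succ_pos n)]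
    have h1 : wordA σ 1 < ((n + 1 : ℕ) : ℤ) + 1 := by
      have := wordA_succ σ 0
      simp only [Fin.val_zero, zero_add] at this
      rw [this]
      have := (σ 0).2
      omega
    have h0 : stepWeight x 0 (Function.update (wordA σ) 0 (((n + 1 : ℕ) : ℤ) + 1) 0)
        (Function.update (wordA σ) 0 (((n + 1 : ℕ) : ℤ) + 1) (0 + 1)) = 1 := by
      rw [Function.update_self, Function.update_of_ne (by omega), stepWeight_of_gt x h1]
      simp [descentWeight]
    rw [h0, one_mul]
    refine Finset.prod_congr rfl fun i hi => ?_
    have := (Finset.mem_Ico.1 hi).1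
    rw [Function.update_of_ne (by omega), Function.update_of_ne (by omega)]

theorem aeval_altEulerianA (n : ℕ) :
    Polynomial.aeval x (altEulerianA n) = rankSumA x n n 0 := by
  have hrank : rankIn (Finset.Icc 1 (n : ℤ)) (n + 1) = n := by
    have : (Finset.Icc 1 (n : ℤ)).filter (· < (n : ℤ) + 1) = Finset.Icc 1 (n : ℤ) :=
      Finset.filter_true_of_mem fun a ha => by have := (Finset.mem_Icc.1 ha).2; omega
    rw [rankIn, this]
    simp
  have hT := wordSum_id x n (Finset.Icc 1 (n : ℤ)) (by simp) 0 (n + 1) (by simp)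
  rw [hrank] at hT
  rw [← hT, altEulerianA, map_sum, wordSum]
  simp only [map_pow, Polynomial.aeval_X, pow_card_altDescentsA]
  refine Finset.sum_bij (fun σ _ j => ((σ j : ℕ) + 1 : ℤ)) ?_ ?_ ?_ ?_
  · intro σ _
    refine mem_distinctWords.2 ⟨fun j => ?_, fun j k h => ?_⟩
    · have := (σ j).2
      rw [Finset.mem_Icc]
      omega
    · simp only [Function.comp_apply, id] at h
      exact σ.injective (Fin.ext (by omega))
  · intro σ _ τ _ h
    refine Equiv.ext fun j => Fin.ext ?_
    have : ((σ j : ℕ) + 1 : ℤ) = (τ j : ℕ) + 1 := congrFun h j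
    omega
  · intro f hf
    obtain ⟨hmem, hinj⟩ := mem_distinctWords.1 hf
    have hb : ∀ j, 1 ≤ f j ∧ f j ≤ n := fun j => Finset.mem_Icc.1 (hmem j)
    let g : Fin n → Fin n := fun j => ⟨(f j - 1).toNat, by have := hb j; omega⟩
    have hg : Function.Injective g := by
      intro j k h
      have h' : (f j - 1).toNat = (f k - 1).toNat := congrArg Fin.val h
      have h1 := hb j
      have h2 := hb k
      exact hinj (show f j = f k by omega)
    refine ⟨Equiv.ofBijective g (Finite.injective_iff_bijective.1 hg), Finset.mem_univ _, ?_⟩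
    funext j
    have := hb j
    simp only [Equiv.ofBijective_apply, g]
    omega
  · intro _ _
    rfl

/-- The positive number `j + 1` as an element of `[±n]`. -/
def PlusMinus.ofFin {n : ℕ} (j : Fin n) : PlusMinus n :=
  ⟨(j : ℕ) + 1, by
    have := j.2
    simp only [Finset.mem_erase, Finset.mem_Icc]
    omega⟩

theorem PlusMinus.bounds {n : ℕ} (a : PlusMinus n) : (a : ℤ) ≠ 0 ∧ -(n : ℤ) ≤ a ∧ (a : ℤ) ≤ n := by
  have := a.2
  simpa only [Finset.mem_erase, Finset.mem_Icc] using this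

theorem PlusMinus.eq_ofFin_or_neg {n : ℕ} (a : PlusMinus n) :
    ∃ j : Fin n, (a = PlusMinus.ofFin j ∧ 0 < (a : ℤ)) ∨
      ((a : ℤ) = -(PlusMinus.ofFin j : ℤ) ∧ (a : ℤ) < 0) := by
  obtain ⟨h0, h1, h2⟩ := a.bounds
  refine ⟨⟨(a : ℤ).natAbs - 1, by omega⟩, ?_⟩
  rcases lt_or_gt_of_ne h0 with h | h
  · exact Or.inr ⟨by simp only [PlusMinus.ofFin]; omega, h⟩
  · exact Or.inl ⟨Subtype.ext (by simp only [PlusMinus.ofFin]; omega), h⟩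

theorem wordB_zero {n : ℕ} (σ : SignedPerm n) : wordB σ 0 = 0 := by
  simp [wordB]

theorem wordB_succ {n : ℕ} (σ : SignedPerm n) (j : Fin n) :
    wordB σ (j + 1) = σ.1 (PlusMinus.ofFin j) := by
  have h := (PlusMinus.ofFin j).2
  have h' : (((j : ℕ) + 1 : ℕ) : ℤ) ∈ (Finset.Icc (-(n : ℤ)) n).erase 0 := by
    simpa [PlusMinus.ofFin] using h
  rw [wordB, dif_pos h']
  rfl

theorem pow_card_altDescentsB {n : ℕ} (σ : SignedPerm n) :
    x ^ (altDescentsB σ).card =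
      wordWeight x 0 0 fun j => (σ.1 (PlusMinus.ofFin j) : ℤ) := by
  rw [wordWeight_eq_prod_range x 0 _ (wordB σ) (wordB_zero σ) (wordB_succ σ), altDescentsB,
    pow_card_filter_eq_prod]

theorem SignedPerm.ext_ofFin {n : ℕ} {σ τ : SignedPerm n}
    (h : ∀ j, (σ.1 (PlusMinus.ofFin j) : ℤ) = τ.1 (PlusMinus.ofFin j)) : σ = τ := by
  refine Subtype.ext (Equiv.ext fun a => Subtype.ext ?_)
  obtain ⟨j, ⟨rfl, _⟩ | ⟨ha, _⟩⟩ := a.eq_ofFin_or_neg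
  · exact h j
  · rw [σ.2 _ a ha, τ.2 _ a ha, h j]

theorem SignedPerm.injective_abs {n : ℕ} (σ : SignedPerm n) :
    Function.Injective fun j : Fin n => |(σ.1 (PlusMinus.ofFin j) : ℤ)| := by
  intro j k h
  rcases abs_eq_abs.1 h with h | h
  · have := congrArg Subtype.val (σ.1.injective (Subtype.ext h))
    simp only [PlusMinus.ofFin] at this
    exact Fin.ext (by omega)
  · let a : PlusMinus n := ⟨-(PlusMinus.ofFin k : ℤ), by
      have := (PlusMinus.ofFin k).bounds
      simp only [Finset.mem_erase, Finset.mem_Icc]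
      omega⟩
    rw [← σ.2 (PlusMinus.ofFin k) a rfl] at h
    have := congrArg Subtype.val (σ.1.injective (Subtype.ext h))
    simp only [PlusMinus.ofFin, a] at this
    omega

theorem SignedPerm.exists_of_word {n : ℕ} (f : Fin n → ℤ) (hf : ∀ j, f j ≠ 0 ∧ |f j| ≤ n)
    (hinj : Function.Injective fun j => |f j|) :
    ∃ σ : SignedPerm n, ∀ j, (σ.1 (PlusMinus.ofFin j) : ℤ) = f j := by
  have hmem : ∀ (j : Fin n) (s : ℤ), s = f j ∨ s = -f j →
      s ∈ (Finset.Icc (-(n : ℤ)) n).erase 0 := by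
    intro j s hs
    have h1 := (hf j).1
    have h2 := abs_le.1 (hf j).2
    simp only [Finset.mem_erase, Finset.mem_Icc]
    omega
  have hidx : ∀ a : PlusMinus n, (a : ℤ).natAbs - 1 < n := by
    intro a
    have := a.bounds
    omega
  let idx : PlusMinus n → Fin n := fun a => ⟨(a : ℤ).natAbs - 1, hidx a⟩
  let g : PlusMinus n → PlusMinus n := fun a =>
    ⟨if 0 < (a : ℤ) then f (idx a) else -f (idx a), hmem (idx a) _ (by split_ifs <;> simp)⟩
  have habs : ∀ a, |(g a : ℤ)| = |f (idx a)| := by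
    intro a
    simp only [g]
    split_ifs <;> simp
  have hg : Function.Injective g := by
    intro a b h
    have hab : idx a = idx b := hinj (by
      change |f (idx a)| = |f (idx b)|
      rw [← habs, ← habs, h])
    have hval : (a : ℤ).natAbs - 1 = (b : ℤ).natAbs - 1 := congrArg Fin.val hab
    have hgab : (if 0 < (a : ℤ) then f (idx a) else -f (idx a)) =
        if 0 < (b : ℤ) then f (idx b) else -f (idx b) := congrArg Subtype.val h
    rw [hab] at hgab
    have h0 := (hf (idx b)).1
    have ha := a.bounds
    have hb := b.bounds
    refine Subtype.ext ?_
    split_ifs at hgab <;> omega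
  refine ⟨⟨Equiv.ofBijective g (Finite.injective_iff_bijective.1 hg), fun a b hab => ?_⟩,
    fun j => ?_⟩
  · have hidxab : idx b = idx a := Fin.ext (by simp only [idx, hab, Int.natAbs_neg])
    have ha := a.bounds
    simp only [Equiv.ofBijective_apply, g, hidxab]
    split_ifs <;> omega
  · have hpos : 0 < (PlusMinus.ofFin j : ℤ) := by simp only [PlusMinus.ofFin]; omega
    have hidxj : idx (PlusMinus.ofFin j) = j := Fin.ext (by
      simp only [idx, PlusMinus.ofFin]; omega)
    simp only [Equiv.ofBijective_apply, g, hpos, if_true, hidxj]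

theorem aeval_altEulerianB (n : ℕ) :
    Polynomial.aeval x (altEulerianB n) = rankSumB x n 0 0 := by
  have hmem : ∀ a : ℤ, a ∈ (Finset.Icc (-(n : ℤ)) n).erase 0 ↔ |a| ∈ Finset.Icc 1 (n : ℤ) := by
    intro a
    simp only [Finset.mem_erase, Finset.mem_Icc, abs_le, ← abs_pos (a := a)]
    rfl
  have hrank : rankIn (Finset.Icc 1 (n : ℤ)) |0| = 0 := by
    rw [rankIn, Finset.card_eq_zero, Finset.filter_eq_empty_iff]
    intro a ha
    have := (Finset.mem_Icc.1 ha).1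
    simp only [abs_zero]
    omega
  have hT := wordSum_abs x n (Finset.Icc 1 (n : ℤ)) _
    (fun m hm => by have := (Finset.mem_Icc.1 hm).1; omega) hmem (by simp) 0 0 (by simp)
  rw [hrank, if_pos le_rfl] at hT
  rw [← hT, altEulerianB, map_sum, wordSum]
  simp only [map_pow, Polynomial.aeval_X, pow_card_altDescentsB]
  refine Finset.sum_bij (fun σ _ j => (σ.1 (PlusMinus.ofFin j) : ℤ)) ?_ ?_ ?_ ?_
  · intro σ _
    exact mem_distinctWords.2 ⟨fun j => (σ.1 (PlusMinus.ofFin j)).2, σ.injective_abs⟩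
  · intro σ _ τ _ h
    exact SignedPerm.ext_ofFin fun j => congrFun h j
  · intro f hf
    obtain ⟨hV, hinj⟩ := mem_distinctWords.1 hf
    obtain ⟨σ, hσ⟩ := SignedPerm.exists_of_word f (fun j => by
      have := hV j
      rw [Finset.mem_erase, Finset.mem_Icc] at this
      exact ⟨this.1, abs_le.2 this.2⟩) hinj
    exact ⟨σ, Finset.mem_univ _, funext hσ⟩
  · intro _ _
    rfl

end Permutations

/-! ### Newton's forward difference formula. -/

section Newton

theorem newton_expansion {R : Type*} [CommRing R] (y : R) (φ : ℕ → ℕ → ℕ → R)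
    (hφ : ∀ k n r, r ≤ n → φ k (n + 1) (r + 1) = φ k (n + 1) r + y * φ (k + 1) n r)
    (r k n : ℕ) (hr : r ≤ n) :
    φ k n r = ∑ p ∈ Finset.HasAntidiagonal.antidiagonal r,
      (r.choose p.1 : R) * (y ^ p.1 * φ (k + p.1) (n - p.1) 0) := by
  induction r generalizing k n with
  | zero => simp
  | succ r ih =>
    obtain ⟨n, rfl⟩ : ∃ m, n = m + 1 := ⟨n - 1, by omega⟩
    rw [hφ k n r (by omega), ih k (n + 1) (by omega), ih (k + 1) n (by omega),
      Finset.sum_antidiagonal_choose_succ_mul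
        (fun p _ => y ^ p * φ (k + p) (n + 1 - p) 0) r, Finset.mul_sum]
    congr 1
    refine Finset.sum_congr rfl fun p hp => ?_
    have hsymm : r.choose p.2 = r.choose p.1 :=
      (Nat.choose_symm_of_eq_add (Finset.HasAntidiagonal.mem_antidiagonal.1 hp).symm).symm
    rw [hsymm, Nat.succ_sub_succ, add_assoc k 1, add_comm 1]
    ring

end Newton

/-! ### Exponential generating functions and the linear systems. -/

section GeneratingFunctions

variable {K : Type*} [Field K] [CharZero K]

/-- The exponential generating function of a sequence. -/
noncomputable def egf (a : ℕ → K) : PowerSeries K := PowerSeries.mk fun n => a n / (n.factorial : K)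

theorem egf_diagonal (y : K) (t : ℕ → ℕ → ℕ → K) (hper : ∀ n r i, t n r (i + 2) = t n r i)
    (ht : ∀ n r i, r ≤ n → t (n + 1) (r + 1) i = t (n + 1) r i + (-1) ^ i * y * t n r (i + 1)) :
    egf (fun n => t n n 0) =
      PowerSeries.rescale y (PowerSeries.cos K) * egf (fun n => t n 0 0) +
        PowerSeries.rescale y (PowerSeries.sin K) * egf (fun n => t n 0 1) := by
  have heven : ∀ m n r, t n r (2 * m) = t n r 0 := by
    intro m n r
    induction m with
    | zero => rfl
    | succ m ih => rw [mul_add, mul_one, hper, ih]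
  have hodd : ∀ m n r, t n r (2 * m + 1) = t n r 1 := by
    intro m n r
    induction m with
    | zero => rfl
    | succ m ih => rw [mul_add, mul_one, add_right_comm, hper, ih]
  -- The factor (-1)^(k/2) absorbs the alternating sign (-1)^k of the recurrence; it is also the
  -- sign pattern of the cosine and sine coefficients.
  have hφ : ∀ k n r, r ≤ n → (-1 : K) ^ (k / 2) * t (n + 1) (r + 1) k =
      (-1) ^ (k / 2) * t (n + 1) r k + y * ((-1) ^ ((k + 1) / 2) * t n r (k + 1)) := by
    intro k n r hr
    rw [ht n r k hr]
    rcases Nat.even_or_odd' k with ⟨m, rfl | rfl⟩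
    · rw [show 2 * m / 2 = m by omega, show (2 * m + 1) / 2 = m by omega, pow_mul]
      ring
    · rw [show (2 * m + 1) / 2 = m by omega, show (2 * m + 1 + 1) / 2 = m + 1 by omega,
        pow_succ (-1 : K) (2 * m), pow_mul]
      ring
  ext n
  have hmain := newton_expansion y (fun k n r => (-1 : K) ^ (k / 2) * t n r k) hφ n 0 n le_rfl
  simp only [Nat.zero_div, pow_zero, one_mul, zero_add] at hmain
  rw [map_add, PowerSeries.coeff_mul, PowerSeries.coeff_mul, ← Finset.sum_add_distrib, egf,
    PowerSeries.coeff_mk, hmain, Finset.sum_div]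
  refine Finset.sum_congr rfl fun p hp => ?_
  have hp' : p.1 + p.2 = n := Finset.HasAntidiagonal.mem_antidiagonal.1 hp
  have hsub : n - p.1 = p.2 := by omega
  have hch : ((n.choose p.1 : ℕ) : K) / n.factorial =
      1 / (p.1.factorial : K) * (1 / (p.2.factorial : K)) := by
    have h1 : (n.factorial : K) ≠ 0 := Nat.cast_ne_zero.2 n.factorial_ne_zero
    have h2 : (p.1.factorial : K) ≠ 0 := Nat.cast_ne_zero.2 p.1.factorial_ne_zero
    have h3 : (p.2.factorial : K) ≠ 0 := Nat.cast_ne_zero.2 p.2.factorial_ne_zero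
    have h4 := Nat.choose_mul_factorial_mul_factorial (show p.1 ≤ n by omega)
    rw [hsub] at h4
    have h5 : ((n.choose p.1 : ℕ) : K) * p.1.factorial * p.2.factorial = n.factorial := by
      exact_mod_cast h4
    rw [div_mul_div_comm, one_mul, div_eq_div_iff h1 (mul_ne_zero h2 h3), ← h5]
    ring
  rw [hsub, mul_div_right_comm, hch]
  simp only [egf, PowerSeries.coeff_rescale, PowerSeries.cos, PowerSeries.sin, PowerSeries.coeff_mk]
  rcases Nat.even_or_odd' p.1 with ⟨m, hm | hm⟩
  · have he : Even p.1 := ⟨m, by omega⟩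
    have htm : t p.2 0 p.1 = t p.2 0 0 := by rw [hm, heven]
    simp only [he, if_true, htm, map_div₀, map_pow, map_neg, map_one, map_natCast]
    ring
  · have he : ¬ Even p.1 := Nat.not_even_iff_odd.2 ⟨m, hm⟩
    have htm : t p.2 0 p.1 = t p.2 0 1 := by rw [hm, hodd]
    simp only [he, if_false, htm, map_div₀, map_pow, map_neg, map_one, map_natCast]
    ring

theorem rescale_neg_cos (y : K) :
    PowerSeries.rescale (-y) (PowerSeries.cos K) = PowerSeries.rescale y (PowerSeries.cos K) := by
  ext n
  simp only [PowerSeries.coeff_rescale, PowerSeries.cos, PowerSeries.coeff_mk]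
  split_ifs with h
  · rw [h.neg_pow]
  · simp

theorem rescale_neg_sin (y : K) :
    PowerSeries.rescale (-y) (PowerSeries.sin K) = -PowerSeries.rescale y (PowerSeries.sin K) := by
  ext n
  simp only [map_neg, PowerSeries.coeff_rescale, PowerSeries.sin, PowerSeries.coeff_mk]
  split_ifs with h
  · simp
  · rw [(Nat.not_even_iff_odd.1 h).neg_pow, neg_mul]

theorem egf_eq_one_add {a b : ℕ → K} {x : K} (ha : a 0 = 1) (hb : b 0 = 1)
    (h : ∀ n, a (n + 1) = x * b (n + 1)) :
    egf a = 1 + PowerSeries.C x * (egf b - 1) := by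
  ext n
  cases n with
  | zero => simp [egf, ha, hb]
  | succ n => simp [egf, h, PowerSeries.coeff_one, mul_div_assoc]

/-- Shifting i by one replaces y by -y in the recurrence; cosine is even and sine is odd. -/
theorem egf_diagonal_one (y : K) (t : ℕ → ℕ → ℕ → K) (hper : ∀ n r i, t n r (i + 2) = t n r i)
    (ht : ∀ n r i, r ≤ n → t (n + 1) (r + 1) i = t (n + 1) r i + (-1) ^ i * y * t n r (i + 1)) :
    egf (fun n => t n n 1) =
      PowerSeries.rescale y (PowerSeries.cos K) * egf (fun n => t n 0 1) -
        PowerSeries.rescale y (PowerSeries.sin K) * egf (fun n => t n 0 0) := by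
  have h := egf_diagonal (-y) (fun n r i => t n r (i + 1)) (fun n r i => hper n r (i + 1))
    (fun n r i hr => by rw [ht n r (i + 1) hr]; ring)
  have h2 : ∀ n, t n 0 (1 + 1) = t n 0 0 := fun n => hper n 0 0
  simp only [rescale_neg_cos, rescale_neg_sin, zero_add, h2] at h
  rw [h]
  ring

theorem egf_rankSumA_diagonal (x : K) :
    egf (fun n => rankSumA x n n 0) = secTan x * egf (fun n => rankSumA x n 0 0) := by
  have h := egf_diagonal_one (1 - x) (rankSumA x) (rankSumA_add_two x) (rankSumA_step x)
  have h1 : (fun n => rankSumA x n 0 1) = fun n => rankSumA x n n 0 := by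
    funext n
    simpa using rankSumA_reflect x n n 0 le_rfl
  have h2 : (fun n => rankSumA x n n 1) = fun n => rankSumA x n 0 0 := by
    funext n
    simpa using rankSumA_reflect x n 0 0 (Nat.zero_le n)
  rw [h1, h2] at h
  have hcs : PowerSeries.rescale (1 - x) (PowerSeries.cos K) *
      PowerSeries.rescale (1 - x) (secSeries K) = 1 := by
    rw [← map_mul, cos_mul_secSeries, map_one]
  have htan : PowerSeries.rescale (1 - x) (tanSeries K) =
      PowerSeries.rescale (1 - x) (PowerSeries.sin K) *
        PowerSeries.rescale (1 - x) (secSeries K) := map_mul _ _ _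
  rw [secTan, htan]
  linear_combination (-PowerSeries.rescale (1 - x) (secSeries K)) * h -
    egf (fun n => rankSumA x n n 0) * hcs

theorem egf_rankSumA_sub_one_mul_denomA (x : K) :
    (egf (fun n => rankSumA x n n 0) - 1) * denomA x = secTan x - 1 := by
  have h := egf_rankSumA_diagonal x
  have h0 := egf_eq_one_add (a := fun n => rankSumA x n 0 0) (b := fun n => rankSumA x n n 0)
    rfl rfl (rankSumA_succ_zero x)
  rw [h0] at h
  rw [denomA]
  linear_combination h

theorem egf_rankSumB_mul_denomB (x : K) :
    egf (fun n => rankSumB x n 0 0) * denomB x = PowerSeries.C (x - 1) := by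
  have h0 := egf_diagonal (1 - x) (rankSumB x) (rankSumB_add_two x) (rankSumB_step x)
  have h1 := egf_diagonal_one (1 - x) (rankSumB x) (rankSumB_add_two x) (rankSumB_step x)
  have hpar : (fun n => rankSumB x n 0 1) = fun n => rankSumB x n 0 0 :=
    funext fun n => rankSumB_zero_succ x n 0
  have hdiag := egf_eq_one_add (a := fun n => rankSumB x n n 1) (b := fun n => rankSumB x n n 0)
    rfl rfl (rankSumB_diag_one x)
  rw [hpar] at h0 h1
  rw [h0, h1] at hdiag
  rw [denomB, map_sub, map_add, map_one]
  linear_combination -hdiag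

end GeneratingFunctions

theorem theorem3 {K : Type*} [Field K] [CharZero K] (x : K) (hx : x ≠ 1) :
    (PowerSeries.mk (fun n : ℕ =>
        if 0 < n then Polynomial.aeval x (altEulerianA n) / (n.factorial : K) else 0) =
      (secTan x - 1) * (denomA x)⁻¹) ∧
    (PowerSeries.mk (fun n : ℕ => Polynomial.aeval x (altEulerianB n) / (n.factorial : K)) =
      PowerSeries.C (x - 1) * (denomB x)⁻¹) := by
  constructor
  · have h : PowerSeries.mk (fun n : ℕ =>
        if 0 < n then Polynomial.aeval x (altEulerianA n) / (n.factorial : K) else 0) =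
        egf (fun n => rankSumA x n n 0) - 1 := by
      ext n
      cases n with
      | zero => simp [egf, rankSumA]
      | succ n => simp [egf, PowerSeries.coeff_one, aeval_altEulerianA]
    rw [h, ← egf_rankSumA_sub_one_mul_denomA, mul_assoc, denomA_mul_inv x hx, mul_one]
  · simp only [aeval_altEulerianB]
    rw [← egf_rankSumB_mul_denomB, mul_assoc, denomB_mul_inv x hx, mul_one]
    rfl
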